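/- Let $n\ge 2$, let $B^n(x,r)$, $\overline{B}^n(x,r)$ and $S^{n-1}(x,r)$ denote the open ball, the closed ball and the sphere with centre $x$ and radius $r$ in Euclidean space $\mathbb{R}^n$, put $\mathbb{B}^n=B^n(0,1)$, and let $\rho$ be the hyperbolic distance of $\mathbb{B}^n$, given by $$\sinh^2\frac{\rho(x,y)}{2}=\frac{|x-y|^2}{(1-|x|^2)(1-|y|^2)},\qquad \rho(x,y)\ge 0,\quad x,y\in\mathbb{B}^n.$$ (i) Let $s\in(0,1)$ and $C(s)\ge 1$, and let $u:\mathbb{B}^n\to(0,\infty)$ be a continuous function that satisfies the $(s,C(s))$-Harnack inequality in $\mathbb{B}^n$, that is, $$\max_{\overline{B}^n(z,s\delta)}u\le C(s)\min_{\overline{B}^n(z,s\delta)}u\qquad\text{whenever } \delta>0 \text{ and } B^n(z,\delta)\subset\mathbb{B}^n.$$ Then for all $x,y\in\mathbb{B}^n$ $$u(x)\le C(s)^{1+t}\,u(y),\qquad t=\frac{\log\frac{1+r}{1-r}}{\log\frac{1+s}{1-s}},\qquad r=\tanh\frac{\rho(x,y)}{2}.$$ (ii) Let $u$ be a positive harmonic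 function on $\mathbb{B}^n$, $x\in\mathbb{B}^n$, $s\in(0,1)$ and $y\in S^{n-1}(x,s(1-|x|))$. Then $$u(x)\le\frac{1}{1-s^2}\left(\frac{1+s}{1-s}\right)^n u(y)\qquad\text{and}\qquad s<\exp(\rho(x,y))-1.$$ -/

import Mathlib

open Metric

/-- A continuous function `u : G → [0, ∞)` (only the values on `G` matter) satisfies the
`(s, C)`-Harnack inequality in `G`: `max u ≤ C * min u` on the closed ball of centre `x` and
radius `s * r`, whenever the open ball of centre `x` and radius `r` lies in `G`. (For `0 < s < 1`
that closed ball is a nonempty compact subset of `G`, so the supremum and the infimum are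
attained.) -/
structure SatisfiesHarnack {n : ℕ} (G : Set (EuclideanSpace ℝ (Fin n))) (s C : ℝ)
    (u : EuclideanSpace ℝ (Fin n) → ℝ) : Prop where
  continuousOn : ContinuousOn u G
  nonneg : ∀ x ∈ G, 0 ≤ u x
  sSup_le : ∀ (x : EuclideanSpace ℝ (Fin n)) (r : ℝ), 0 < r → ball x r ⊆ G →
    sSup (u '' closedBall x (s * r)) ≤ C * sInf (u '' closedBall x (s * r))

/-- The hyperbolic distance of the unit ball (curvature `-1`), for points of norm `< 1`. -/
noncomputable def hypDist {n : ℕ} (x y : EuclideanSpace ℝ (Fin n)) : ℝ :=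
  2 * Real.arsinh (‖x - y‖ / Real.sqrt ((1 - ‖x‖ ^ 2) * (1 - ‖y‖ ^ 2)))

/-- The hyperbolic distance `ρ` of the unit ball satisfies
`sinh² (ρ(x,y)/2) = |x-y|² / ((1-|x|²)(1-|y|²))`. -/
theorem sinh_sq_half_hypDist {n : ℕ} {x y : EuclideanSpace ℝ (Fin n)}
    (hx : x ∈ ball (0 : EuclideanSpace ℝ (Fin n)) 1)
    (hy : y ∈ ball (0 : EuclideanSpace ℝ (Fin n)) 1) :
    Real.sinh (hypDist x y / 2) ^ 2 = ‖x - y‖ ^ 2 / ((1 - ‖x‖ ^ 2) * (1 - ‖y‖ ^ 2)) := by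
  rw [mem_ball_zero_iff] at hx hy
  have h1 : 0 ≤ 1 - ‖x‖ ^ 2 := by nlinarith [norm_nonneg x]
  have h2 : 0 ≤ 1 - ‖y‖ ^ 2 := by nlinarith [norm_nonneg y]
  rw [hypDist, mul_div_cancel_left₀ _ two_ne_zero, Real.sinh_arsinh, div_pow,
    Real.sq_sqrt (mul_nonneg h1 h2)]

/-!
For (i), a hyperbolic ball of radius `artanh s` is a Euclidean ball contained in the closed ball of
radius `s * δ` about its Euclidean centre, where `δ` is the distance of that centre to the unit
sphere. Two points at hyperbolic distance at most `2 * artanh s` lie in such a ball about their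
hyperbolic midpoint, so one Harnack inequality compares the values of `u` there. A geodesic from
`x` to `y` is covered by at most `1 + ρ(x, y) / (2 * artanh s) = 1 + t` steps of this length, and
its intermediate points come from the hyperboloid model.

For (ii), a positive harmonic function satisfies a mean value property with the weight
`(1 - ‖z‖²)₊` rescaled to any ball. Comparing the weights of two internally tangent balls gives a
Harnack inequality whose derivative at the centre is the gradient estimate
`R * |∂ᵥ u(y)| ≤ (n + 1) * ‖v‖ * u(y)` on a ball of radius `R`, and integrating it along the segment
from `x` to `y` yields the factor `(1 - s) ^ (-(n + 1))`. This is at most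
`(1 - s²)⁻¹ * ((1 + s) / (1 - s)) ^ n`, since the quotient is `(1 + s) ^ (n - 1)`.
The bound `s < exp ρ(x, y) - 1` compares `cosh ρ(x, y) = 1 + 2 * sinh² (ρ(x, y) / 2)` with
`cosh (log (1 + s))`.
-/

section Paraboloid

open MeasureTheory

variable {E : Type*} [NormedAddCommGroup E]

/-- The truncated paraboloid `z ↦ (1 - ‖z‖²)₊`, the weight of the mean values taken over balls. It
is chosen because its square is continuously differentiable with gradient `-4 (1 - ‖z‖²)₊ z`. -/
noncomputable def paraboloid (z : E) : ℝ :=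
  max 0 (1 - ‖z‖ ^ 2)

theorem paraboloid_nonneg (z : E) : 0 ≤ paraboloid z :=
  le_max_left _ _

theorem paraboloid_of_one_le_norm {z : E} (hz : 1 ≤ ‖z‖) : paraboloid z = 0 :=
  max_eq_left (by nlinarith)

theorem paraboloid_of_norm_le_one {z : E} (hz : ‖z‖ ≤ 1) : paraboloid z = 1 - ‖z‖ ^ 2 :=
  max_eq_right (by nlinarith [norm_nonneg z])

@[fun_prop]
theorem continuous_paraboloid : Continuous (paraboloid : E → ℝ) := by
  unfold paraboloid
  fun_prop

theorem paraboloid_inv_smul_sub_of_notMem_ball [NormedSpace ℝ E] {w y : E} {ρ : ℝ} (hρ : 0 < ρ)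
    (hw : w ∉ ball y ρ) : paraboloid (ρ⁻¹ • (w - y)) = 0 := by
  refine paraboloid_of_one_le_norm ?_
  rw [norm_smul, norm_inv, Real.norm_of_nonneg hρ.le, inv_mul_eq_div, one_le_div hρ]
  simpa [dist_eq_norm] using hw

theorem paraboloid_inv_smul_sub_of_mem_ball [NormedSpace ℝ E] {w y : E} {ρ : ℝ}
    (hw : w ∈ ball y ρ) : paraboloid (ρ⁻¹ • (w - y)) = 1 - (dist w y / ρ) ^ 2 := by
  have hρ : 0 < ρ := dist_nonneg.trans_lt hw
  have hnorm : ‖ρ⁻¹ • (w - y)‖ = dist w y / ρ := by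
    rw [norm_smul, norm_inv, Real.norm_of_nonneg hρ.le, inv_mul_eq_div, dist_eq_norm]
  rw [paraboloid_of_norm_le_one, hnorm]
  rw [hnorm, div_le_one hρ]
  exact (mem_ball.1 hw).le

/-- Under the internal tangency `r + dist x y = ρ` the difference of the two sides is
`dist x y * (r - dist w x) ^ 2 / (r * ρ)` as soon as `dist w y` is replaced by its upper bound
`dist w x + dist x y`. -/
theorem mul_paraboloid_inv_smul_sub_le [NormedSpace ℝ E] {x y : E} {r ρ : ℝ} (hr : 0 < r)
    (hρ : r + dist x y = ρ) (w : E) :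
    r * paraboloid (r⁻¹ • (w - x)) ≤ ρ * paraboloid (ρ⁻¹ • (w - y)) := by
  have hρ₀ : 0 < ρ := by linarith [dist_nonneg (x := x) (y := y)]
  by_cases hwx : w ∈ ball x r
  · have hwy : w ∈ ball y ρ := ball_subset_ball' hρ.le hwx
    rw [paraboloid_inv_smul_sub_of_mem_ball hwx, paraboloid_inv_smul_sub_of_mem_ball hwy]
    have hslack : 0 ≤ dist x y * (r - dist w x) ^ 2 / (r * ρ) := by positivity
    calc r * (1 - (dist w x / r) ^ 2)
        ≤ r * (1 - (dist w x / r) ^ 2) + dist x y * (r - dist w x) ^ 2 / (r * ρ) := by linarith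
      _ = ρ * (1 - ((dist w x + dist x y) / ρ) ^ 2) := by
        subst hρ
        field_simp
        ring
      _ ≤ ρ * (1 - (dist w y / ρ) ^ 2) := by
        gcongr
        exact dist_triangle w x y
  · rw [paraboloid_inv_smul_sub_of_notMem_ball hr hwx, mul_zero]
    exact mul_nonneg hρ₀.le (paraboloid_nonneg _)

section Integral

variable [ProperSpace E]

theorem hasCompactSupport_paraboloid : HasCompactSupport (paraboloid : E → ℝ) :=
  HasCompactSupport.intro (isCompact_closedBall (0 : E) 1) fun z hz ↦ by
    rw [mem_closedBall_zero_iff, not_le] at hz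
    exact paraboloid_of_one_le_norm hz.le

variable [MeasurableSpace E] [BorelSpace E] {μ : Measure E} [IsFiniteMeasureOnCompacts μ]

theorem integral_paraboloid_pos [μ.IsOpenPosMeasure] : 0 < ∫ z, paraboloid z ∂μ :=
  continuous_paraboloid.integral_pos_of_hasCompactSupport_nonneg_nonzero
    hasCompactSupport_paraboloid paraboloid_nonneg (x := 0) (by simp [paraboloid])

theorem integrable_paraboloid_mul {g : E → ℝ} (hg : Continuous g) :
    Integrable (fun z ↦ paraboloid z * g z) μ :=
  (continuous_paraboloid.mul hg).integrable_of_hasCompactSupport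
    hasCompactSupport_paraboloid.mul_right

theorem integrable_paraboloid_sq_mul {g : E → ℝ} (hg : Continuous g) :
    Integrable (fun z ↦ paraboloid z ^ 2 * g z) μ := by
  simpa only [pow_two, mul_assoc, Pi.mul_apply] using
    integrable_paraboloid_mul (continuous_paraboloid.mul hg)

theorem integrable_paraboloid_inv_smul_sub_mul [NormedSpace ℝ E] {u : E → ℝ} {y : E} {ρ : ℝ}
    (hρ : 0 < ρ) (hu : ContinuousOn u (closedBall y ρ)) :
    Integrable (fun w ↦ paraboloid (ρ⁻¹ • (w - y)) * u w) μ := by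
  have hweight : Continuous fun w : E ↦ paraboloid (ρ⁻¹ • (w - y)) :=
    continuous_paraboloid.comp (by fun_prop)
  refine (integrableOn_iff_integrable_of_support_subset fun w hw ↦ ?_).1
    ((hweight.continuousOn.mul hu).integrableOn_compact (isCompact_closedBall y ρ))
  by_contra hwy
  exact hw (by simp only [paraboloid_inv_smul_sub_of_notMem_ball hρ
    (mt (fun h ↦ ball_subset_closedBall h) hwy), zero_mul])

end Integral

theorem hasDerivAt_max_zero_sq (t : ℝ) :
    HasDerivAt (fun x : ℝ ↦ max 0 x ^ 2) (2 * max 0 t) t := by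
  have hquad (x : ℝ) : |max 0 x ^ 2 - max 0 t ^ 2 - 2 * max 0 t * (x - t)| ≤ (x - t) ^ 2 := by
    rw [abs_le]
    rcases max_cases 0 x with ⟨hx, hx'⟩ | ⟨hx, hx'⟩ <;>
      rcases max_cases 0 t with ⟨ht, ht'⟩ | ⟨ht, ht'⟩ <;> rw [hx, ht] <;> constructor <;> nlinarith
  have hbigO : (fun x ↦ max 0 x ^ 2 - max 0 t ^ 2 - 2 * max 0 t * (x - t)) =O[nhds t]
      fun x ↦ ‖x - t‖ ^ 2 :=
    Asymptotics.isBigO_of_le _ fun x ↦ by simpa [abs_of_nonneg] using hquad x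
  have haffine : HasDerivAt (fun x ↦ max 0 t ^ 2 + 2 * max 0 t * (x - t)) (2 * max 0 t) t := by
    simpa using (((hasDerivAt_id t).sub_const t).const_mul (2 * max 0 t)).const_add (max 0 t ^ 2)
  refine ((hbigO.hasFDerivAt one_lt_two).hasDerivAt.add haffine).congr_deriv (by simp)
    |>.congr_of_eventuallyEq (.of_forall fun x ↦ ?_)
  simp only [Pi.add_apply]
  ring

variable [InnerProductSpace ℝ E]

theorem hasFDerivAt_paraboloid_sq (z : E) :
    HasFDerivAt (fun z : E ↦ paraboloid z ^ 2) ((-4 * paraboloid z) • innerSL ℝ z) z := by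
  have hinner : HasFDerivAt (fun z : E ↦ 1 - ‖z‖ ^ 2) (-(2 • innerSL ℝ z)) z :=
    (hasStrictFDerivAt_norm_sq z).hasFDerivAt.const_sub 1
  refine ((hasDerivAt_max_zero_sq (1 - ‖z‖ ^ 2)).comp_hasFDerivAt z hinner).congr_fderiv ?_
  ext v
  simp only [paraboloid, smul_apply, neg_apply, innerSL_apply_apply, smul_eq_mul, nsmul_eq_mul]
  push_cast
  ring

variable [FiniteDimensional ℝ E] [MeasurableSpace E] [BorelSpace E] {μ : Measure E}
  [μ.IsAddHaarMeasure]

theorem integral_paraboloid_mul_inner_mul (v : E) {g : E → ℝ} (hg : ContDiff ℝ 1 g) :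
    ∫ z, paraboloid z * (inner ℝ z v * g z) ∂μ
      = 4⁻¹ * ∫ z, paraboloid z ^ 2 * fderiv ℝ g z v ∂μ := by
  have hderiv (z : E) : fderiv ℝ (fun z : E ↦ paraboloid z ^ 2) z v * g z
      = -4 * (paraboloid z * (inner ℝ z v * g z)) := by
    rw [(hasFDerivAt_paraboloid_sq z).fderiv, smul_apply, innerSL_apply_apply, smul_eq_mul]
    ring
  have hcont : Continuous fun z ↦ fderiv ℝ g z v :=
    (hg.continuous_fderiv one_ne_zero).clm_apply continuous_const
  have hparts := integral_mul_fderiv_eq_neg_fderiv_mul_of_integrable (μ := μ)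
    (f := fun z : E ↦ paraboloid z ^ 2) (g := g) (v := v)
    (by
      simp only [hderiv]
      exact (integrable_paraboloid_mul
        ((continuous_id.inner continuous_const).mul hg.continuous)).const_mul _)
    (integrable_paraboloid_sq_mul hcont) (integrable_paraboloid_sq_mul hg.continuous)
    (fun z _ ↦ (hasFDerivAt_paraboloid_sq z).differentiableAt)
    (fun z _ ↦ hg.differentiable one_ne_zero z)
  simp only [hderiv, integral_const_mul] at hparts
  linarith

end Paraboloid

section Cutoff

open scoped Topology Manifold

theorem exists_contDiff_hasCompactSupport_eventuallyEq {E F : Type*} [NormedAddCommGroup E]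
    [NormedSpace ℝ E] [FiniteDimensional ℝ E] [NormedAddCommGroup F] [NormedSpace ℝ F]
    {u : E → F} {K : Set E} (hK : IsCompact K) {n : ℕ} (hu : ∀ z ∈ K, ContDiffAt ℝ n u z) :
    ∃ U : E → F, ContDiff ℝ n U ∧ HasCompactSupport U ∧ ∀ᶠ z in 𝓝ˢ K, U z = u z := by
  have hopen : IsOpen {z | ContDiffAt ℝ n u z} :=
    isOpen_iff_mem_nhds.2 fun z hz ↦ ContDiffAt.eventually hz (by simp)
  obtain ⟨L, hL, hKL, hLu⟩ := exists_compact_between hK hopen hu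
  obtain ⟨χ, hχ_one, hχ_zero, -⟩ :=
    exists_contMDiffMap_one_nhds_of_subset_interior (n := n) 𝓘(ℝ, E) hK.isClosed hKL
  refine ⟨fun z ↦ χ z • u z, contDiff_iff_contDiffAt.2 fun z ↦ ?_,
    HasCompactSupport.intro hL fun z hz ↦ by simp only [hχ_zero z hz, zero_smul],
    hχ_one.mono fun z hz ↦ by simp only [hz, one_smul]⟩
  by_cases hz : z ∈ L
  · exact χ.contMDiff.contDiff.contDiffAt.smul (hLu hz)
  · refine (contDiffAt_const (c := (0 : F))).congr_of_eventuallyEq ?_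
    filter_upwards [hL.isClosed.isOpen_compl.mem_nhds hz] with w hw
    rw [hχ_zero w hw, zero_smul]

end Cutoff

section DerivIntegral

open MeasureTheory

theorem hasDerivAt_integral_mul_comp_add_smul {E : Type*} [NormedAddCommGroup E]
    [NormedSpace ℝ E] [MeasurableSpace E] [BorelSpace E] {μ : Measure E}
    [IsFiniteMeasureOnCompacts μ] {w U : E → ℝ} (hw : Continuous w)
    (hwc : HasCompactSupport w) (hU : ContDiff ℝ 1 U) (hUc : HasCompactSupport U) (y : E) (r : ℝ) :
    HasDerivAt (fun r : ℝ ↦ ∫ z, w z * U (y + r • z) ∂μ)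
      (∫ z, w z * fderiv ℝ U (y + r • z) z ∂μ) r := by
  obtain ⟨K, hK⟩ := (hUc.fderiv (𝕜 := ℝ)).exists_bound_of_continuous
    (hU.continuous_fderiv one_ne_zero)
  have hU_cont := hU.continuous
  have := hU.continuous_fderiv one_ne_zero
  have hintegrable {g : E → ℝ} (hg : Continuous g) : Integrable (fun z ↦ w z * g z) μ :=
    (hw.mul hg).integrable_of_hasCompactSupport hwc.mul_right
  refine (hasDerivAt_integral_of_dominated_loc_of_deriv_le (s := Set.univ)
    (F := fun r z ↦ w z * U (y + r • z))
    (F' := fun r z ↦ w z * fderiv ℝ U (y + r • z) z)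
    (bound := fun z : E ↦ ‖w z * (K * ‖z‖)‖) Filter.univ_mem
    (.of_forall fun r ↦ (hintegrable (by fun_prop)).aestronglyMeasurable)
    (hintegrable (by fun_prop)) (hintegrable (by fun_prop)).aestronglyMeasurable
    (.of_forall fun z r _ ↦ ?_)
    (hintegrable (by fun_prop)).norm (.of_forall fun z r _ ↦ ?_)).2
  · rw [norm_mul, norm_mul]
    gcongr
    exact ((fderiv ℝ U (y + r • z)).le_of_opNorm_le (hK _) z).trans (le_abs_self _)
  · have hline : HasDerivAt (fun r : ℝ ↦ y + r • z) z r := by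
      simpa using ((hasDerivAt_id r).smul_const z).const_add y
    exact ((hU.differentiable one_ne_zero _).hasFDerivAt.comp_hasDerivAt r hline).const_mul _

end DerivIntegral

section MeanValue

open MeasureTheory Module Laplacian InnerProductSpace
open scoped Topology

variable {E : Type*} [NormedAddCommGroup E] [InnerProductSpace ℝ E] [FiniteDimensional ℝ E]

theorem laplacian_eq_sum_fderiv_fderiv {ι : Type*} [Fintype ι] (b : OrthonormalBasis ι ℝ E)
    {V : E → ℝ} (hV : ContDiff ℝ 2 V) (z : E) :
    Δ V z = ∑ i, fderiv ℝ (fun z ↦ fderiv ℝ V z (b i)) z (b i) := by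
  rw [laplacian_eq_iteratedFDeriv_orthonormalBasis V b]
  refine Finset.sum_congr rfl fun i _ ↦ ?_
  have hdiff : DifferentiableAt ℝ (fderiv ℝ V) z :=
    (hV.fderiv_right (m := 1) (by norm_num)).differentiable one_ne_zero z
  rw [iteratedFDeriv_two_apply, fderiv_clm_apply hdiff (differentiableAt_const _)]
  simp

theorem laplacian_comp_add_smul {U : E → ℝ} (hU : ContDiff ℝ 2 U) (y : E) (r : ℝ) (z : E) :
    Δ (fun z ↦ U (y + r • z)) z = r ^ 2 * Δ U (y + r • z) := by
  have hshift : ContDiff ℝ 2 fun z ↦ U (y + z) := hU.comp (contDiff_const.add contDiff_id)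
  rw [laplacian_eq_iteratedFDeriv_stdOrthonormalBasis,
    laplacian_eq_iteratedFDeriv_stdOrthonormalBasis, Finset.mul_sum]
  have := iteratedFDeriv_comp_const_smul r (i := 2) hshift
  simp only [this, iteratedFDeriv_comp_add_left]
  simp

variable [MeasurableSpace E] [BorelSpace E]

/-- Green's identity for the weight `(1 - ‖z‖²)₊`, whose boundary terms vanish. -/
theorem integral_paraboloid_mul_fderiv_self {V : E → ℝ} (hV : ContDiff ℝ 2 V) :
    ∫ z : E, paraboloid z * fderiv ℝ V z z = 4⁻¹ * ∫ z, paraboloid z ^ 2 * Δ V z := by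
  let b := stdOrthonormalBasis ℝ E
  have hpartial (i) : ContDiff ℝ 1 fun z : E ↦ fderiv ℝ V z (b i) :=
    (hV.fderiv_right (by norm_num)).clm_apply contDiff_const
  have hexpand (z : E) : paraboloid z * fderiv ℝ V z z
      = ∑ i, paraboloid z * (inner ℝ z (b i) * fderiv ℝ V z (b i)) := by
    rw [← Finset.mul_sum]
    conv_lhs => rw [← congrArg (fderiv ℝ V z) (b.sum_repr' z), map_sum]
    simp only [map_smul, smul_eq_mul, real_inner_comm]
  have hintegrable (i) : Integrable fun z : E ↦
      paraboloid z * (inner ℝ z (b i) * fderiv ℝ V z (b i)) :=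
    integrable_paraboloid_mul
      ((continuous_id.inner continuous_const).mul (hpartial i).continuous)
  have hlaplacian_integrable (i) : Integrable fun z : E ↦
      paraboloid z ^ 2 * fderiv ℝ (fun z ↦ fderiv ℝ V z (b i)) z (b i) :=
    integrable_paraboloid_sq_mul
      (((hpartial i).continuous_fderiv one_ne_zero).clm_apply continuous_const)
  simp only [hexpand, laplacian_eq_sum_fderiv_fderiv b hV, Finset.mul_sum]
  rw [integral_finsetSum _ fun i _ ↦ hintegrable i,
    integral_finsetSum _ fun i _ ↦ hlaplacian_integrable i, Finset.mul_sum]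
  exact Finset.sum_congr rfl fun i _ ↦ integral_paraboloid_mul_inner_mul _ (hpartial i)

theorem integral_paraboloid_mul_fderiv_comp_add_smul {U : E → ℝ} (hU : ContDiff ℝ 2 U) {y : E}
    {r : ℝ} (hr : 0 < r) (hΔ : ∀ z ∈ ball y r, Δ U z = 0) :
    ∫ z : E, paraboloid z * fderiv ℝ U (y + r • z) z = 0 := by
  let V : E → ℝ := fun z ↦ U (y + r • z)
  have hV : ContDiff ℝ 2 V := hU.comp (contDiff_const.add (contDiff_const_smul r))
  have hfderiv (z : E) : fderiv ℝ V z = r • fderiv ℝ U (y + r • z) := by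
    rw [fderiv_comp_smul (f := fun z ↦ U (y + z)), fderiv_comp_add_left]
  have hzero (z : E) : paraboloid z ^ 2 * Δ V z = 0 := by
    rcases le_or_gt 1 ‖z‖ with hz | hz
    · rw [paraboloid_of_one_le_norm hz, zero_pow two_ne_zero, zero_mul]
    · have hmem : y + r • z ∈ ball y r := by
        rw [mem_ball, dist_eq_norm, add_sub_cancel_left, norm_smul, Real.norm_of_nonneg hr.le]
        nlinarith
      rw [laplacian_comp_add_smul hU, hΔ _ hmem, mul_zero, mul_zero]
  have hgreen := integral_paraboloid_mul_fderiv_self hV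
  simp only [hzero, integral_zero, mul_zero, hfderiv, smul_apply, smul_eq_mul, mul_left_comm _ r,
    integral_const_mul] at hgreen
  exact (mul_eq_zero.1 hgreen).resolve_left hr.ne'

theorem integral_paraboloid_mul_comp_add_smul {U : E → ℝ} (hU : ContDiff ℝ 2 U)
    (hUc : HasCompactSupport U) {y : E} {ρ : ℝ} (hρ : 0 < ρ) (hΔ : ∀ z ∈ ball y ρ, Δ U z = 0) :
    ∫ z : E, paraboloid z * U (y + ρ • z) = (∫ z : E, paraboloid z) * U y := by
  have hderiv := hasDerivAt_integral_mul_comp_add_smul (μ := volume) continuous_paraboloid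
    hasCompactSupport_paraboloid (hU.of_le one_le_two) hUc y
  obtain ⟨r, ⟨hr, hrρ⟩, hslope⟩ := exists_hasDerivAt_eq_slope _ _ hρ
    (fun r _ ↦ (hderiv r).continuousAt.continuousWithinAt) fun r _ ↦ hderiv r
  rw [integral_paraboloid_mul_fderiv_comp_add_smul hU hr
    fun z hz ↦ hΔ z (ball_subset_ball hrρ.le hz), eq_comm, div_eq_zero_iff,
    or_iff_left (sub_pos.2 hρ).ne', sub_eq_zero] at hslope
  simpa [integral_mul_const] using hslope

theorem integral_paraboloid_inv_smul_sub_mul_of_harmonicOnNhd {u : E → ℝ} {y : E} {ρ : ℝ}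
    (hρ : 0 < ρ) (hu : HarmonicOnNhd u (closedBall y ρ)) :
    ∫ w : E, paraboloid (ρ⁻¹ • (w - y)) * u w
      = ρ ^ finrank ℝ E * ((∫ z : E, paraboloid z) * u y) := by
  obtain ⟨U, hU, hUc, hUu⟩ := exists_contDiff_hasCompactSupport_eventuallyEq
    (isCompact_closedBall y ρ) (n := 2) fun z hz ↦ (hu z hz).1
  have hUu_nhds (z : E) (hz : z ∈ closedBall y ρ) : U =ᶠ[𝓝 z] u :=
    hUu.filter_mono (nhds_le_nhdsSet hz)
  have hΔ (z : E) (hz : z ∈ ball y ρ) : Δ U z = 0 :=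
    have hz' := ball_subset_closedBall hz
    (laplacian_congr_nhds (hUu_nhds z hz')).self_of_nhds.trans (hu z hz').2.self_of_nhds
  have hweight (w : E) : paraboloid (ρ⁻¹ • (w - y)) * u w
      = paraboloid (ρ⁻¹ • (w - y)) * U (y + ρ • ρ⁻¹ • (w - y)) := by
    rw [smul_inv_smul₀ hρ.ne', add_sub_cancel]
    by_cases hw : w ∈ ball y ρ
    · rw [(hUu_nhds w (ball_subset_closedBall hw)).self_of_nhds]
    · simp only [paraboloid_inv_smul_sub_of_notMem_ball hρ hw, zero_mul]
  simp only [hweight]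
  rw [integral_sub_right_eq_self (fun w ↦ paraboloid (ρ⁻¹ • w) * U (y + ρ • ρ⁻¹ • w)) y,
    Measure.integral_comp_inv_smul_of_nonneg volume (fun z ↦ paraboloid z * U (y + ρ • z)) hρ.le,
    integral_paraboloid_mul_comp_add_smul hU hUc hρ hΔ, smul_eq_mul,
    (hUu_nhds y (mem_closedBall_self hρ.le)).self_of_nhds]

end MeanValue

section HarmonicHarnack

open MeasureTheory Module Laplacian InnerProductSpace
open scoped Topology

variable {E : Type*} [NormedAddCommGroup E] [InnerProductSpace ℝ E] [FiniteDimensional ℝ E]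
  {u : E → ℝ} {x y : E} {ρ R : ℝ}

theorem sub_dist_pow_mul_le_of_harmonicOnNhd_closedBall (hu : HarmonicOnNhd u (closedBall y ρ))
    (hu₀ : ∀ z ∈ ball y ρ, 0 ≤ u z) (hx : dist x y < ρ) :
    (ρ - dist x y) ^ (finrank ℝ E + 1) * u x ≤ ρ ^ (finrank ℝ E + 1) * u y := by
  borelize E
  have hρ : 0 < ρ := dist_nonneg.trans_lt hx
  obtain ⟨r, hr⟩ : ∃ r, r + dist x y = ρ := ⟨ρ - dist x y, by ring⟩
  have hr₀ : 0 < r := by linarith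
  have hux : HarmonicOnNhd u (closedBall x r) := hu.mono (closedBall_subset_closedBall' hr.le)
  have hcont {z : E} {t : ℝ} (hu : HarmonicOnNhd u (closedBall z t)) :
      ContinuousOn u (closedBall z t) :=
    fun w hw ↦ (hu w hw).1.continuousAt.continuousWithinAt
  have hmono := integral_mono (μ := volume)
    ((integrable_paraboloid_inv_smul_sub_mul hr₀ (hcont hux)).const_mul r)
    ((integrable_paraboloid_inv_smul_sub_mul hρ (hcont hu)).const_mul ρ) fun w ↦ by
      by_cases hw : w ∈ ball y ρ
      · simpa only [mul_assoc] using
          mul_le_mul_of_nonneg_right (mul_paraboloid_inv_smul_sub_le hr₀ hr w) (hu₀ w hw)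
      · have hwx : w ∉ ball x r := fun h ↦ hw (ball_subset_ball' hr.le h)
        simp only [paraboloid_inv_smul_sub_of_notMem_ball hr₀ hwx,
          paraboloid_inv_smul_sub_of_notMem_ball hρ hw, zero_mul, mul_zero, le_refl]
  rw [integral_const_mul, integral_const_mul,
    integral_paraboloid_inv_smul_sub_mul_of_harmonicOnNhd hr₀ hux,
    integral_paraboloid_inv_smul_sub_mul_of_harmonicOnNhd hρ hu] at hmono
  rw [← eq_sub_of_add_eq hr]
  refine le_of_mul_le_mul_left ?_ (integral_paraboloid_pos (μ := (volume : Measure E)))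
  calc (∫ z : E, paraboloid z) * (r ^ (finrank ℝ E + 1) * u x)
      = r * (r ^ finrank ℝ E * ((∫ z : E, paraboloid z) * u x)) := by ring
    _ ≤ ρ * (ρ ^ finrank ℝ E * ((∫ z : E, paraboloid z) * u y)) := hmono
    _ = (∫ z : E, paraboloid z) * (ρ ^ (finrank ℝ E + 1) * u y) := by ring

theorem sub_dist_pow_mul_le_of_harmonicOnNhd_ball (hu : HarmonicOnNhd u (ball y R))
    (hu₀ : ∀ z ∈ ball y R, 0 ≤ u z) (hx : x ∈ ball y R) :
    (R - dist x y) ^ (finrank ℝ E + 1) * u x ≤ R ^ (finrank ℝ E + 1) * u y := by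
  have hlim (a c : ℝ) : Filter.Tendsto (fun ρ : ℝ ↦ (ρ - a) ^ (finrank ℝ E + 1) * c) (𝓝[<] R)
      (𝓝 ((R - a) ^ (finrank ℝ E + 1) * c)) :=
    ((by fun_prop : Continuous fun ρ : ℝ ↦ (ρ - a) ^ (finrank ℝ E + 1) * c).tendsto R).mono_left
      nhdsWithin_le_nhds
  refine le_of_tendsto_of_tendsto (hlim (dist x y) (u x)) (by simpa using hlim 0 (u y)) ?_
  filter_upwards [Ioo_mem_nhdsLT (mem_ball.1 hx)] with ρ hρ
  exact sub_dist_pow_mul_le_of_harmonicOnNhd_closedBall (hu.mono (closedBall_subset_ball hρ.2))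
    (fun z hz ↦ hu₀ z (ball_subset_ball hρ.2.le hz)) hρ.1

/-- The one-sided derivative at `h = 0` of the Harnack inequality between `y` and `y - h • v`. -/
theorem neg_mul_le_mul_fderiv_of_harmonicOnNhd_ball (hR : 0 < R) (hu : HarmonicOnNhd u (ball y R))
    (hu₀ : ∀ z ∈ ball y R, 0 ≤ u z) (v : E) :
    -((finrank ℝ E + 1) * ‖v‖ * u y) ≤ R * fderiv ℝ u y v := by
  set N := finrank ℝ E
  let H : ℝ → ℝ := fun h ↦ (R - h * ‖v‖) ^ (N + 1) * u (y - h • v)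
  have hline : HasDerivAt (fun h : ℝ ↦ y - h • v) (-v) 0 := by
    simpa using ((hasDerivAt_id (0 : ℝ)).smul_const v).const_sub y
  have hfderiv : HasFDerivAt u (fderiv ℝ u y) (y - (0 : ℝ) • v) := by
    simpa using ((hu y (mem_ball_self hR)).1.differentiableAt two_ne_zero).hasFDerivAt
  have hH : HasDerivAt H (-(R ^ N * ((N + 1) * ‖v‖ * u y + R * fderiv ℝ u y v))) 0 := by
    refine ((((hasDerivAt_mul_const ‖v‖).const_sub R).pow (N + 1)).mul
      (hfderiv.comp_hasDerivAt (0 : ℝ) hline)).congr_deriv ?_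
    simp only [Nat.cast_add, Nat.cast_one, zero_mul, sub_zero, add_tsub_cancel_right, mul_neg,
      Function.comp_apply, zero_smul, neg_mul, Pi.pow_apply, map_neg]
    ring
  have hH_le : ∀ᶠ h in 𝓝[>] (0 : ℝ), H h ≤ H 0 := by
    have hsmall : ∀ᶠ h in 𝓝 (0 : ℝ), h * ‖v‖ < R :=
      (continuous_mul_const ‖v‖).continuousAt.eventually_lt_const (by simpa using hR)
    filter_upwards [nhdsWithin_le_nhds hsmall, self_mem_nhdsWithin] with h hhR hh
    have hdist : dist (y - h • v) y = h * ‖v‖ := by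
      rw [dist_self_sub_left, norm_smul, Real.norm_of_nonneg (le_of_lt hh)]
    have hharnack := sub_dist_pow_mul_le_of_harmonicOnNhd_ball hu hu₀ (x := y - h • v)
      (by rwa [mem_ball, hdist])
    rw [hdist] at hharnack
    simpa [H] using hharnack
  have hderiv_nonpos : -(R ^ N * ((N + 1) * ‖v‖ * u y + R * fderiv ℝ u y v)) ≤ 0 := by
    have hslope := (hasDerivWithinAt_iff_tendsto_slope' (s := Set.Ioi 0) (by simp)).1
      hH.hasDerivWithinAt
    refine le_of_tendsto hslope ?_
    filter_upwards [hH_le, self_mem_nhdsWithin] with h hh hh₀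
    rw [slope_def_field, sub_zero]
    exact div_nonpos_of_nonpos_of_nonneg (sub_nonpos.2 hh) (le_of_lt hh₀)
  have := (mul_nonneg_iff_of_pos_left (pow_pos hR N)).1 (neg_nonpos.1 hderiv_nonpos)
  linarith

theorem monotoneOn_div_sub_mul_pow {f f' : ℝ → ℝ} {d : ℝ} {k : ℕ} (hd : 0 ≤ d) (hdR : d < R)
    (hf : ∀ t ∈ Set.Icc (0 : ℝ) 1, HasDerivAt f (f' t) t)
    (hf' : ∀ t ∈ Set.Icc (0 : ℝ) 1, -((k + 1) * d * f t) ≤ (R - t * d) * f' t) :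
    MonotoneOn (fun t ↦ f t / (R - t * d) ^ (k + 1)) (Set.Icc 0 1) := by
  have hpos (t : ℝ) (ht : t ∈ Set.Icc (0 : ℝ) 1) : 0 < R - t * d := by
    nlinarith [ht.2]
  have hderiv (t : ℝ) (ht : t ∈ Set.Icc (0 : ℝ) 1) :
      HasDerivAt (fun t ↦ f t / (R - t * d) ^ (k + 1))
        (((R - t * d) * f' t + (k + 1) * d * f t) / (R - t * d) ^ (k + 2)) t := by
    have hR_sub := hpos t ht
    refine ((hf t ht).div (((hasDerivAt_mul_const d).const_sub R).pow (k + 1))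
      (pow_pos hR_sub _).ne').congr_deriv ?_
    simp only [Pi.pow_apply, add_tsub_cancel_right]
    push_cast
    field_simp
    ring
  refine monotoneOn_of_hasDerivWithinAt_nonneg (convex_Icc 0 1)
    (fun t ht ↦ (hderiv t ht).continuousAt.continuousWithinAt)
    (fun t ht ↦ (hderiv t (interior_subset ht)).hasDerivWithinAt) fun t ht ↦ ?_
  have ht' := interior_subset ht
  exact div_nonneg (by linarith [hf' t ht']) (pow_pos (hpos t ht') _).le

theorem sub_dist_pow_mul_center_le_of_harmonicOnNhd_ball (hu : HarmonicOnNhd u (ball x R))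
    (hu₀ : ∀ z ∈ ball x R, 0 ≤ u z) (hy : y ∈ ball x R) :
    (R - dist y x) ^ (finrank ℝ E + 1) * u x ≤ R ^ (finrank ℝ E + 1) * u y := by
  have hyR : dist y x < R := mem_ball.1 hy
  have hR : 0 < R := dist_nonneg.trans_lt hyR
  let γ : ℝ → E := AffineMap.lineMap x y
  have hradius (t : ℝ) (ht : t ∈ Set.Icc (0 : ℝ) 1) : 0 < R - t * dist y x := by
    nlinarith [ht.2, dist_nonneg (x := y) (y := x)]
  have hsub (t : ℝ) (ht : t ∈ Set.Icc (0 : ℝ) 1) : ball (γ t) (R - t * dist y x) ⊆ ball x R := by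
    refine ball_subset_ball' (le_of_eq ?_)
    rw [dist_lineMap_left, Real.norm_of_nonneg ht.1, dist_comm x y]
    ring
  have hderiv (t : ℝ) (ht : t ∈ Set.Icc (0 : ℝ) 1) :
      HasDerivAt (u ∘ γ) (fderiv ℝ u (γ t) (y - x)) t :=
    ((hu _ (hsub t ht (mem_ball_self (hradius t ht)))).1.differentiableAt
      two_ne_zero).hasFDerivAt.comp_hasDerivAt t AffineMap.hasDerivAt_lineMap
  have hmono := monotoneOn_div_sub_mul_pow (k := finrank ℝ E) dist_nonneg hyR hderiv
    fun t ht ↦ by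
      rw [dist_eq_norm y x]
      exact neg_mul_le_mul_fderiv_of_harmonicOnNhd_ball
        (by simpa only [dist_eq_norm] using hradius t ht)
        (by simpa only [dist_eq_norm] using hu.mono (hsub t ht))
        (by simpa only [dist_eq_norm] using fun z hz ↦ hu₀ z (hsub t ht hz)) (y - x)
  have hends := hmono (Set.left_mem_Icc.2 zero_le_one) (Set.right_mem_Icc.2 zero_le_one)
    zero_le_one
  simp only [Function.comp_apply, γ, AffineMap.lineMap_apply_zero, AffineMap.lineMap_apply_one,
    zero_mul, sub_zero, one_mul] at hends
  rw [div_le_div_iff₀ (by positivity) (pow_pos (sub_pos.2 hyR) _)] at hends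
  linarith

theorem le_inv_one_sub_pow_mul_of_mem_sphere (hR : 0 < R) (hu : HarmonicOnNhd u (ball x R))
    (hu₀ : ∀ z ∈ ball x R, 0 ≤ u z) {s : ℝ} (hs : s < 1) (hy : y ∈ sphere x (s * R)) :
    u x ≤ ((1 - s) ^ (finrank ℝ E + 1))⁻¹ * u y := by
  rw [mem_sphere] at hy
  have hharnack := sub_dist_pow_mul_center_le_of_harmonicOnNhd_ball hu hu₀
    (show y ∈ ball x R by rw [mem_ball, hy]; nlinarith)
  rw [hy, show R - s * R = (1 - s) * R by ring, mul_pow, mul_right_comm, mul_comm] at hharnack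
  rw [le_inv_mul_iff₀ (pow_pos (sub_pos.2 hs) _)]
  exact le_of_mul_le_mul_left hharnack (pow_pos hR _)

theorem inv_one_sub_pow_succ_le {s : ℝ} (hs : 0 ≤ s) (hs₁ : s < 1) {n : ℕ} (hn : n ≠ 0) :
    ((1 - s) ^ (n + 1))⁻¹ ≤ 1 / (1 - s ^ 2) * ((1 + s) / (1 - s)) ^ n := by
  have hs' : 0 < 1 - s := sub_pos.2 hs₁
  obtain ⟨k, rfl⟩ := Nat.exists_eq_succ_of_ne_zero hn
  calc ((1 - s) ^ (k + 1 + 1))⁻¹ ≤ (1 + s) ^ k * ((1 - s) ^ (k + 1 + 1))⁻¹ :=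
        le_mul_of_one_le_left (by positivity) (one_le_pow₀ (by linarith))
    _ = 1 / (1 - s ^ 2) * ((1 + s) / (1 - s)) ^ (k + 1) := by
      rw [show 1 - s ^ 2 = (1 - s) * (1 + s) by ring, div_pow]
      field_simp
      ring

end HarmonicHarnack

section HyperbolicDistance

open Real

variable {n : ℕ} {x y m : EuclideanSpace ℝ (Fin n)} {ρ : ℝ}

theorem hypDist_nonneg (x y : EuclideanSpace ℝ (Fin n)) : 0 ≤ hypDist x y :=
  mul_nonneg zero_le_two (arsinh_nonneg_iff.2 (by positivity))

theorem hypDist_comm (x y : EuclideanSpace ℝ (Fin n)) : hypDist x y = hypDist y x := by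
  rw [hypDist, hypDist, norm_sub_rev, mul_comm (1 - ‖x‖ ^ 2)]

theorem hypDist_self (x : EuclideanSpace ℝ (Fin n)) : hypDist x x = 0 := by
  simp [hypDist]

theorem one_sub_norm_sq_pos {E : Type*} [SeminormedAddGroup E] {x : E} (hx : x ∈ ball 0 1) :
    0 < 1 - ‖x‖ ^ 2 := by
  rw [mem_ball_zero_iff] at hx
  nlinarith [norm_nonneg x]

theorem eq_of_hypDist_eq_zero (hx : x ∈ ball 0 1) (hy : y ∈ ball 0 1) (h : hypDist x y = 0) :
    x = y := by
  have hsinh := sinh_sq_half_hypDist hx hy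
  rw [h, zero_div, sinh_zero, zero_pow two_ne_zero, eq_comm, div_eq_zero_iff,
    or_iff_left (mul_pos (one_sub_norm_sq_pos hx) (one_sub_norm_sq_pos hy)).ne'] at hsinh
  exact sub_eq_zero.1 (norm_eq_zero.1 (pow_eq_zero_iff two_ne_zero |>.1 hsinh))

theorem cosh_eq_one_add_two_mul_sinh_half_sq (t : ℝ) : cosh t = 1 + 2 * sinh (t / 2) ^ 2 := by
  conv_lhs => rw [← mul_div_cancel₀ t two_ne_zero, cosh_two_mul, cosh_sq]
  ring

theorem cosh_hypDist (hx : x ∈ ball 0 1) (hy : y ∈ ball 0 1) :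
    cosh (hypDist x y) = ((1 + ‖x‖ ^ 2) * (1 + ‖y‖ ^ 2) - 4 * inner ℝ x y)
      / ((1 - ‖x‖ ^ 2) * (1 - ‖y‖ ^ 2)) := by
  have hx' := one_sub_norm_sq_pos hx
  have hy' := one_sub_norm_sq_pos hy
  rw [cosh_eq_one_add_two_mul_sinh_half_sq, sinh_sq_half_hypDist hx hy, norm_sub_sq_real]
  field_simp
  ring

theorem one_add_dist_div_lt_exp_hypDist (hx : x ∈ ball 0 1) (hy : y ∈ ball 0 1) (hxy : x ≠ y) :
    1 + dist x y / (1 - ‖x‖) < exp (hypDist x y) := by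
  have hx' := one_sub_norm_sq_pos hx
  have hy' := one_sub_norm_sq_pos hy
  have hx₁ : 0 < 1 - ‖x‖ := sub_pos.2 (mem_ball_zero_iff.1 hx)
  have hdist : 0 < dist x y := dist_pos.2 hxy
  have hprod : (1 - ‖x‖ ^ 2) * (1 - ‖y‖ ^ 2) < 2 * (1 - ‖x‖) * (2 * (1 - ‖x‖ + dist x y)) := by
    have hnorm : ‖x‖ - ‖y‖ ≤ dist x y := dist_eq_norm x y ▸ norm_sub_norm_le x y
    exact mul_lt_mul'' (by nlinarith) (by nlinarith [sq_nonneg (1 - ‖y‖)]) hx'.le hy'.le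
  have hcosh : cosh (log (1 + dist x y / (1 - ‖x‖))) < cosh (hypDist x y) := by
    calc cosh (log (1 + dist x y / (1 - ‖x‖)))
        = 1 + 2 * (dist x y ^ 2 / (2 * (1 - ‖x‖) * (2 * (1 - ‖x‖ + dist x y)))) := by
          rw [cosh_log (by positivity)]
          field_simp
          ring
      _ < 1 + 2 * (dist x y ^ 2 / ((1 - ‖x‖ ^ 2) * (1 - ‖y‖ ^ 2))) := by gcongr
      _ = cosh (hypDist x y) := by
          rw [cosh_eq_one_add_two_mul_sinh_half_sq (hypDist x y), sinh_sq_half_hypDist hx hy,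
            dist_eq_norm]
  rw [cosh_lt_cosh, abs_of_nonneg (hypDist_nonneg x y)] at hcosh
  rw [← log_lt_iff_lt_exp (by positivity)]
  exact (le_abs_self _).trans_lt hcosh

/-- The hyperbolic ball of centre `m` and radius `ρ` is the Euclidean ball of centre `A⁻¹ • m` and
radius `A⁻¹ * ((1 - ‖m‖ ^ 2) * sinh ρ / 2)` where `A = hypBallScale m ρ`. -/
noncomputable def hypBallScale (m : EuclideanSpace ℝ (Fin n)) (ρ : ℝ) : ℝ :=
  1 + sinh (ρ / 2) ^ 2 * (1 - ‖m‖ ^ 2)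

/-- The Euclidean centre of the hyperbolic ball of centre `m` and radius `ρ`. -/
noncomputable def hypBallCenter (m : EuclideanSpace ℝ (Fin n)) (ρ : ℝ) :
    EuclideanSpace ℝ (Fin n) :=
  (hypBallScale m ρ)⁻¹ • m

theorem one_le_hypBallScale (hm : m ∈ ball 0 1) (ρ : ℝ) : 1 ≤ hypBallScale m ρ :=
  le_add_of_nonneg_right (mul_nonneg (sq_nonneg _) (one_sub_norm_sq_pos hm).le)

theorem norm_hypBallCenter (hm : m ∈ ball 0 1) (ρ : ℝ) :
    ‖hypBallCenter m ρ‖ = ‖m‖ / hypBallScale m ρ := by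
  rw [hypBallCenter, norm_smul, norm_inv, inv_mul_eq_div,
    Real.norm_of_nonneg (zero_le_one.trans (one_le_hypBallScale hm ρ))]

theorem hypBallCenter_mem_ball (hm : m ∈ ball 0 1) (ρ : ℝ) : hypBallCenter m ρ ∈ ball 0 1 := by
  have hA := one_le_hypBallScale hm ρ
  rw [mem_ball_zero_iff, norm_hypBallCenter hm, div_lt_one (by linarith)]
  exact (mem_ball_zero_iff.1 hm).trans_le hA

theorem norm_hypBallScale_smul_sub_le (hx : x ∈ ball 0 1) (hm : m ∈ ball 0 1)
    (h : hypDist x m ≤ ρ) :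
    ‖hypBallScale m ρ • x - m‖ ≤ (1 - ‖m‖ ^ 2) * sinh ρ / 2 := by
  have hm' := one_sub_norm_sq_pos hm
  have hxm := hypDist_nonneg x m
  have hsinh : sinh ρ = 2 * sinh (ρ / 2) * cosh (ρ / 2) := by
    rw [← sinh_two_mul, mul_div_cancel₀ ρ two_ne_zero]
  have hA := one_le_hypBallScale hm ρ
  have hdist : ‖x - m‖ ^ 2 ≤ sinh (ρ / 2) ^ 2 * ((1 - ‖x‖ ^ 2) * (1 - ‖m‖ ^ 2)) := by
    rw [← div_le_iff₀ (mul_pos (one_sub_norm_sq_pos hx) hm'), ← sinh_sq_half_hypDist hx hm]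
    exact pow_le_pow_left₀ (sinh_nonneg_iff.2 (by linarith)) (sinh_le_sinh.2 (by linarith)) 2
  have hlinear : hypBallScale m ρ * ‖x‖ ^ 2 - 2 * inner ℝ x m
      ≤ hypBallScale m ρ - 1 - ‖m‖ ^ 2 := by
    rw [norm_sub_sq_real] at hdist
    rw [hypBallScale]
    linarith
  refine le_of_sq_le_sq ?_ (div_nonneg (mul_nonneg hm'.le
    (sinh_nonneg_iff.2 (hxm.trans h))) zero_le_two)
  calc ‖hypBallScale m ρ • x - m‖ ^ 2
      = hypBallScale m ρ * (hypBallScale m ρ * ‖x‖ ^ 2 - 2 * inner ℝ x m) + ‖m‖ ^ 2 := by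
        rw [norm_sub_sq_real, norm_smul, real_inner_smul_left, mul_pow, Real.norm_eq_abs, sq_abs]
        ring
    _ ≤ hypBallScale m ρ * (hypBallScale m ρ - 1 - ‖m‖ ^ 2) + ‖m‖ ^ 2 := by gcongr
    _ = ((1 - ‖m‖ ^ 2) * sinh ρ / 2) ^ 2 := by
      rw [hsinh, div_pow, mul_pow, mul_pow, mul_pow, cosh_sq, hypBallScale]
      ring

theorem one_sub_norm_sq_mul_sinh_div_two_le (hm : m ∈ ball 0 1) (hρ : 0 ≤ ρ) :
    (1 - ‖m‖ ^ 2) * sinh ρ / 2 ≤ tanh ρ * (hypBallScale m ρ - ‖m‖) := by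
  have hm₁ : ‖m‖ < 1 := mem_ball_zero_iff.1 hm
  have htanh : 0 ≤ tanh ρ := by
    rw [tanh_eq_sinh_div_cosh]
    exact div_nonneg (sinh_nonneg_iff.2 hρ) (cosh_pos ρ).le
  calc (1 - ‖m‖ ^ 2) * sinh ρ / 2
      = tanh ρ * ((1 - ‖m‖) * ((1 + ‖m‖) / 2 + (1 + ‖m‖) * sinh (ρ / 2) ^ 2)) := by
        rw [← div_mul_cancel₀ (sinh ρ) (cosh_pos ρ).ne', ← tanh_eq_sinh_div_cosh,
          cosh_eq_one_add_two_mul_sinh_half_sq ρ]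
        ring
    _ ≤ tanh ρ * ((1 - ‖m‖) * (1 + (1 + ‖m‖) * sinh (ρ / 2) ^ 2)) := by
        have := sub_pos.2 hm₁
        gcongr
        linarith
    _ = tanh ρ * (hypBallScale m ρ - ‖m‖) := by
        rw [hypBallScale]
        ring

theorem mem_closedBall_hypBallCenter (hx : x ∈ ball 0 1) (hm : m ∈ ball 0 1)
    (h : hypDist x m ≤ ρ) :
    x ∈ closedBall (hypBallCenter m ρ) (tanh ρ * (1 - ‖hypBallCenter m ρ‖)) := by
  have hA : 0 < hypBallScale m ρ := zero_lt_one.trans_le (one_le_hypBallScale hm ρ)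
  rw [mem_closedBall, norm_hypBallCenter hm]
  calc dist x (hypBallCenter m ρ) = (hypBallScale m ρ)⁻¹ * ‖hypBallScale m ρ • x - m‖ := by
        rw [dist_eq_norm, ← Real.norm_of_nonneg (inv_nonneg.2 hA.le), ← norm_smul, smul_sub,
          inv_smul_smul₀ hA.ne', hypBallCenter]
    _ ≤ (hypBallScale m ρ)⁻¹ * (tanh ρ * (hypBallScale m ρ - ‖m‖)) := by
        gcongr
        exact (norm_hypBallScale_smul_sub_le hx hm h).trans
          (one_sub_norm_sq_mul_sinh_div_two_le hm ((hypDist_nonneg x m).trans h))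
    _ = tanh ρ * (1 - ‖m‖ / hypBallScale m ρ) := by field_simp

end HyperbolicDistance

section Hyperboloid

open Real

section LorentzForm

variable {E : Type*} [NormedAddCommGroup E] [InnerProductSpace ℝ E]

/-- The Lorentz form on `ℝ × E`. The hyperboloid model of hyperbolic space consists of the `p` with
`lorentzForm p p = 1` and `0 ≤ p.1`. -/
def lorentzForm : LinearMap.BilinForm ℝ (ℝ × E) :=
  LinearMap.mk₂ ℝ (fun p q ↦ p.1 * q.1 - inner ℝ p.2 q.2)
    (fun p p' q ↦ by
      simp only [Prod.fst_add, Prod.snd_add, inner_add_left]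
      ring)
    (fun c p q ↦ by
      simp only [Prod.smul_fst, Prod.smul_snd, real_inner_smul_left, smul_eq_mul]
      ring)
    (fun p q q' ↦ by
      simp only [Prod.fst_add, Prod.snd_add, inner_add_right]
      ring)
    (fun c p q ↦ by
      simp only [Prod.smul_fst, Prod.smul_snd, real_inner_smul_right, smul_eq_mul]
      ring)

theorem lorentzForm_apply (p q : ℝ × E) : lorentzForm p q = p.1 * q.1 - inner ℝ p.2 q.2 :=
  rfl

theorem lorentzForm_comm (p q : ℝ × E) : lorentzForm p q = lorentzForm q p := by
  rw [lorentzForm_apply, lorentzForm_apply, mul_comm, real_inner_comm]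

/-- The map from the unit ball to the hyperboloid inverse to the stereographic projection. -/
noncomputable def toHyperboloid (x : E) : ℝ × E :=
  ((1 + ‖x‖ ^ 2) / (1 - ‖x‖ ^ 2), (2 / (1 - ‖x‖ ^ 2)) • x)

/-- The stereographic projection from the point `(-1, 0)` of the hyperboloid to the unit ball. -/
noncomputable def ofHyperboloid (p : ℝ × E) : E :=
  (1 + p.1)⁻¹ • p.2

theorem toHyperboloid_fst_nonneg {x : E} (hx : x ∈ ball 0 1) : 0 ≤ (toHyperboloid x).1 :=
  div_nonneg (by positivity) (one_sub_norm_sq_pos hx).le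

variable {p : ℝ × E}

theorem one_sub_norm_ofHyperboloid_sq (hp₀ : 0 ≤ p.1) (hp : lorentzForm p p = 1) :
    1 - ‖ofHyperboloid p‖ ^ 2 = 2 / (1 + p.1) := by
  rw [lorentzForm_apply, real_inner_self_eq_norm_sq] at hp
  rw [ofHyperboloid, norm_smul, mul_pow, norm_inv, Real.norm_eq_abs, inv_pow, sq_abs,
    show ‖p.2‖ ^ 2 = p.1 * p.1 - 1 by linarith]
  field_simp
  ring

theorem ofHyperboloid_mem_ball (hp₀ : 0 ≤ p.1) (hp : lorentzForm p p = 1) :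
    ofHyperboloid p ∈ ball 0 1 := by
  have hpos : 0 < 1 - ‖ofHyperboloid p‖ ^ 2 := by
    rw [one_sub_norm_ofHyperboloid_sq hp₀ hp]
    positivity
  rw [mem_ball_zero_iff]
  nlinarith [norm_nonneg (ofHyperboloid p)]

theorem toHyperboloid_ofHyperboloid (hp₀ : 0 ≤ p.1) (hp : lorentzForm p p = 1) :
    toHyperboloid (ofHyperboloid p) = p := by
  have hnorm := one_sub_norm_ofHyperboloid_sq hp₀ hp
  have hp₁ : 1 + p.1 ≠ 0 := by positivity
  rw [toHyperboloid, hnorm, ← sub_sub_cancel 1 (‖ofHyperboloid p‖ ^ 2), hnorm]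
  ext1
  · field_simp
    ring
  · rw [ofHyperboloid, smul_smul, div_div_cancel₀ two_ne_zero, mul_inv_cancel₀ hp₁, one_smul]

/-- The point at distance `a` from `P` and `b` from `Q` on the geodesic of the hyperboloid joining
two points `P` and `Q` at distance `a + b`. -/
noncomputable def hyperboloidGeodesic (P Q : ℝ × E) (a b : ℝ) : ℝ × E :=
  (sinh b / sinh (a + b)) • P + (sinh a / sinh (a + b)) • Q

variable {P Q : ℝ × E} {a b : ℝ}

theorem hyperboloidGeodesic_comm (P Q : ℝ × E) (a b : ℝ) :
    hyperboloidGeodesic P Q a b = hyperboloidGeodesic Q P b a := by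
  rw [hyperboloidGeodesic, hyperboloidGeodesic, add_comm, add_comm a b]

theorem hyperboloidGeodesic_fst_nonneg (hP : 0 ≤ P.1) (hQ : 0 ≤ Q.1) (ha : 0 ≤ a) (hb : 0 ≤ b) :
    0 ≤ (hyperboloidGeodesic P Q a b).1 := by
  have hsinh {t : ℝ} (ht : 0 ≤ t) : 0 ≤ sinh t / sinh (a + b) :=
    div_nonneg (sinh_nonneg_iff.2 ht) (sinh_nonneg_iff.2 (add_nonneg ha hb))
  exact add_nonneg (mul_nonneg (hsinh hb) hP) (mul_nonneg (hsinh ha) hQ)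

theorem sinh_add_sinh_mul_cosh_add (a b : ℝ) :
    sinh b + sinh a * cosh (a + b) = cosh a * sinh (a + b) := by
  rw [cosh_add, sinh_add]
  linear_combination (-sinh b) * cosh_sq a

theorem lorentzForm_left_hyperboloidGeodesic (hP : lorentzForm P P = 1)
    (hPQ : lorentzForm P Q = cosh (a + b)) (hab : 0 < a + b) :
    lorentzForm P (hyperboloidGeodesic P Q a b) = cosh a := by
  have hsinh : sinh (a + b) ≠ 0 := (sinh_pos_iff.2 hab).ne'
  rw [hyperboloidGeodesic, map_add, map_smul, map_smul, hP, hPQ, smul_eq_mul, smul_eq_mul, mul_one,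
    div_mul_eq_mul_div, ← add_div, sinh_add_sinh_mul_cosh_add, mul_div_cancel_right₀ _ hsinh]

theorem lorentzForm_right_hyperboloidGeodesic (hQ : lorentzForm Q Q = 1)
    (hPQ : lorentzForm P Q = cosh (a + b)) (hab : 0 < a + b) :
    lorentzForm Q (hyperboloidGeodesic P Q a b) = cosh b := by
  rw [lorentzForm_comm, add_comm] at hPQ
  rw [hyperboloidGeodesic_comm, lorentzForm_left_hyperboloidGeodesic hQ hPQ (by rwa [add_comm])]

theorem lorentzForm_hyperboloidGeodesic_self (hP : lorentzForm P P = 1) (hQ : lorentzForm Q Q = 1)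
    (hPQ : lorentzForm P Q = cosh (a + b)) (hab : 0 < a + b) :
    lorentzForm (hyperboloidGeodesic P Q a b) (hyperboloidGeodesic P Q a b) = 1 := by
  have hsinh : sinh (a + b) ≠ 0 := (sinh_pos_iff.2 hab).ne'
  rw [lorentzForm_comm]
  nth_rw 2 [hyperboloidGeodesic]
  rw [map_add, map_smul, map_smul, lorentzForm_comm _ P, lorentzForm_comm _ Q,
    lorentzForm_left_hyperboloidGeodesic hP hPQ hab,
    lorentzForm_right_hyperboloidGeodesic hQ hPQ hab, smul_eq_mul, smul_eq_mul,
    div_mul_eq_mul_div, div_mul_eq_mul_div, ← add_div, div_eq_one_iff_eq hsinh, sinh_add]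
  ring

end LorentzForm

variable {n : ℕ} {x y : EuclideanSpace ℝ (Fin n)}

theorem lorentzForm_toHyperboloid (hx : x ∈ ball 0 1) (hy : y ∈ ball 0 1) :
    lorentzForm (toHyperboloid x) (toHyperboloid y) = cosh (hypDist x y) := by
  have hx' := one_sub_norm_sq_pos hx
  have hy' := one_sub_norm_sq_pos hy
  rw [cosh_hypDist hx hy, lorentzForm_apply, toHyperboloid, toHyperboloid, real_inner_smul_left,
    real_inner_smul_right]
  field_simp
  ring

theorem lorentzForm_toHyperboloid_self (hx : x ∈ ball 0 1) :
    lorentzForm (toHyperboloid x) (toHyperboloid x) = 1 := by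
  rw [lorentzForm_toHyperboloid hx hx, hypDist_self, cosh_zero]

theorem exists_hypDist_eq_and_hypDist_eq (hx : x ∈ ball 0 1) (hy : y ∈ ball 0 1) {a b : ℝ}
    (ha : 0 ≤ a) (hb : 0 ≤ b) (hxy : hypDist x y = a + b) :
    ∃ z ∈ ball (0 : EuclideanSpace ℝ (Fin n)) 1, hypDist x z = a ∧ hypDist z y = b := by
  rcases (add_nonneg ha hb).eq_or_lt with hzero | hab
  · obtain ⟨rfl, rfl⟩ := (add_eq_zero_iff_of_nonneg ha hb).1 hzero.symm
    exact ⟨x, hx, hypDist_self x, by rw [hxy, add_zero]⟩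
  have hX := lorentzForm_toHyperboloid_self hx
  have hY := lorentzForm_toHyperboloid_self hy
  have hXY : lorentzForm (toHyperboloid x) (toHyperboloid y) = cosh (a + b) := by
    rw [lorentzForm_toHyperboloid hx hy, hxy]
  have hp := lorentzForm_hyperboloidGeodesic_self hX hY hXY hab
  have hp₀ := hyperboloidGeodesic_fst_nonneg (toHyperboloid_fst_nonneg hx)
    (toHyperboloid_fst_nonneg hy) ha hb
  have hz := ofHyperboloid_mem_ball hp₀ hp
  refine ⟨_, hz, cosh_injOn (hypDist_nonneg _ _) ha ?_, cosh_injOn (hypDist_nonneg _ _) hb ?_⟩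
  · rw [← lorentzForm_toHyperboloid hx hz, toHyperboloid_ofHyperboloid hp₀ hp,
      lorentzForm_left_hyperboloidGeodesic hX hXY hab]
  · rw [← lorentzForm_toHyperboloid hz hy, toHyperboloid_ofHyperboloid hp₀ hp, lorentzForm_comm,
      lorentzForm_right_hyperboloidGeodesic hY hXY hab]

end Hyperboloid

section HarnackChain

open Real

theorem log_one_add_div_one_sub {r : ℝ} (hr : r ∈ Set.Icc (-1) 1) :
    log ((1 + r) / (1 - r)) = 2 * artanh r := by
  rw [artanh_eq_half_log hr]
  ring

namespace SatisfiesHarnack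

variable {n : ℕ} {s C : ℝ} {u : EuclideanSpace ℝ (Fin n) → ℝ} {x y : EuclideanSpace ℝ (Fin n)}

theorem le_mul_of_mem_closedBall {G : Set (EuclideanSpace ℝ (Fin n))}
    (hu : SatisfiesHarnack G s C u) (hs : s < 1) (hC : 0 ≤ C) {c : EuclideanSpace ℝ (Fin n)}
    {δ : ℝ} (hδ : 0 < δ) (hG : ball c δ ⊆ G) (hx : x ∈ closedBall c (s * δ))
    (hy : y ∈ closedBall c (s * δ)) : u x ≤ C * u y := by
  have hsub : closedBall c (s * δ) ⊆ G := (closedBall_subset_ball (by nlinarith)).trans hG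
  have hcompact : IsCompact (u '' closedBall c (s * δ)) :=
    (isCompact_closedBall c (s * δ)).image_of_continuousOn (hu.continuousOn.mono hsub)
  calc u x ≤ sSup (u '' closedBall c (s * δ)) :=
        le_csSup hcompact.bddAbove (Set.mem_image_of_mem u hx)
    _ ≤ C * sInf (u '' closedBall c (s * δ)) := hu.sSup_le c δ hδ hG
    _ ≤ C * u y := by
        gcongr
        exact csInf_le hcompact.bddBelow (Set.mem_image_of_mem u hy)

theorem le_mul_of_hypDist_le (hu : SatisfiesHarnack (ball 0 1) s C u) (hs : -1 < s) (hs₁ : s < 1)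
    (hC : 0 ≤ C) (hx : x ∈ ball 0 1) (hy : y ∈ ball 0 1) (hxy : hypDist x y ≤ 2 * artanh s) :
    u x ≤ C * u y := by
  have hxy₀ := hypDist_nonneg x y
  obtain ⟨m, hm, hxm, hmy⟩ := exists_hypDist_eq_and_hypDist_eq hx hy
    (div_nonneg hxy₀ zero_le_two) (div_nonneg hxy₀ zero_le_two) (add_halves _).symm
  have hmem {z : EuclideanSpace ℝ (Fin n)} (hz : z ∈ ball 0 1) (hzm : hypDist z m ≤ artanh s) :
      z ∈ closedBall (hypBallCenter m (artanh s)) (s * (1 - ‖hypBallCenter m (artanh s)‖)) := by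
    simpa only [tanh_artanh ⟨hs, hs₁⟩] using mem_closedBall_hypBallCenter hz hm hzm
  refine hu.le_mul_of_mem_closedBall hs₁ hC
    (sub_pos.2 (mem_ball_zero_iff.1 (hypBallCenter_mem_ball hm _)))
    (ball_subset_ball' (by simp)) (hmem hx (by linarith)) (hmem hy ?_)
  rw [hypDist_comm]
  linarith

theorem le_pow_mul_of_hypDist_le (hu : SatisfiesHarnack (ball 0 1) s C u) (hs : 0 ≤ s)
    (hs₁ : s < 1) (hC : 0 ≤ C) (k : ℕ) (hx : x ∈ ball 0 1) (hy : y ∈ ball 0 1)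
    (hxy : hypDist x y ≤ k * (2 * artanh s)) : u x ≤ C ^ k * u y := by
  have hstep : 0 ≤ 2 * artanh s := mul_nonneg zero_le_two (artanh_nonneg hs)
  induction k generalizing x with
  | zero =>
    rw [Nat.cast_zero, zero_mul] at hxy
    rw [eq_of_hypDist_eq_zero hx hy (hxy.antisymm (hypDist_nonneg x y)), pow_zero, one_mul]
  | succ k ih =>
    rw [Nat.cast_succ, add_one_mul] at hxy
    obtain ⟨z, hz, hxz, hzy⟩ := exists_hypDist_eq_and_hypDist_eq hx hy
      (a := min (2 * artanh s) (hypDist x y)) (le_min hstep (hypDist_nonneg x y))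
      (sub_nonneg.2 (min_le_right _ _)) (add_sub_cancel _ _).symm
    have hzy_le : hypDist z y ≤ k * (2 * artanh s) := by
      rw [hzy, sub_le_comm]
      exact le_min (by linarith) (sub_le_self _ (by positivity))
    calc u x ≤ C * u z :=
          hu.le_mul_of_hypDist_le (by linarith) hs₁ hC hx hz (hxz.le.trans (min_le_left _ _))
      _ ≤ C * (C ^ k * u y) := mul_le_mul_of_nonneg_left (ih hz hzy_le) hC
      _ = C ^ (k + 1) * u y := by ring

theorem le_rpow_mul (hu : SatisfiesHarnack (ball 0 1) s C u) (hs : 0 < s) (hs₁ : s < 1)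
    (hC : 1 ≤ C) (hx : x ∈ ball 0 1) (hy : y ∈ ball 0 1) :
    u x ≤ C ^ (1 + hypDist x y / (2 * artanh s)) * u y := by
  have hstep : 0 < 2 * artanh s := mul_pos two_pos (artanh_pos ⟨hs, hs₁⟩)
  set q := hypDist x y / (2 * artanh s)
  have hq : 0 ≤ q := div_nonneg (hypDist_nonneg x y) hstep.le
  calc u x ≤ C ^ ⌈q⌉₊ * u y :=
        hu.le_pow_mul_of_hypDist_le hs.le hs₁ (zero_le_one.trans hC) ⌈q⌉₊ hx hy
          ((div_le_iff₀ hstep).1 (Nat.le_ceil q))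
    _ = C ^ (⌈q⌉₊ : ℝ) * u y := by rw [rpow_natCast]
    _ ≤ C ^ (1 + q) * u y := by
        refine mul_le_mul_of_nonneg_right (rpow_le_rpow_of_exponent_le hC ?_) (hu.nonneg y hy)
        linarith [Nat.ceil_lt_add_one hq]

end SatisfiesHarnack

end HarnackChain

theorem mainTheorem9 (n : ℕ) (hn : 2 ≤ n) :
    (∀ (s C : ℝ) (u : EuclideanSpace ℝ (Fin n) → ℝ), 0 < s → s < 1 → 1 ≤ C →
      (∀ x ∈ Metric.ball (0 : EuclideanSpace ℝ (Fin n)) 1, 0 < u x) →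
      SatisfiesHarnack (Metric.ball (0 : EuclideanSpace ℝ (Fin n)) 1) s C u →
      ∀ x ∈ Metric.ball (0 : EuclideanSpace ℝ (Fin n)) 1,
      ∀ y ∈ Metric.ball (0 : EuclideanSpace ℝ (Fin n)) 1,
      ∀ r t : ℝ, r = Real.tanh (hypDist x y / 2) →
        t = Real.log ((1 + r) / (1 - r)) / Real.log ((1 + s) / (1 - s)) →
        u x ≤ C ^ (1 + t) * u y) ∧
    (∀ u : EuclideanSpace ℝ (Fin n) → ℝ,
      InnerProductSpace.HarmonicOnNhd u (Metric.ball (0 : EuclideanSpace ℝ (Fin n)) 1) →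
      (∀ x ∈ Metric.ball (0 : EuclideanSpace ℝ (Fin n)) 1, 0 < u x) →
      ∀ x ∈ Metric.ball (0 : EuclideanSpace ℝ (Fin n)) 1, ∀ s : ℝ, 0 < s → s < 1 →
      ∀ y ∈ Metric.sphere x (s * (1 - ‖x‖)),
        u x ≤ 1 / (1 - s ^ 2) * ((1 + s) / (1 - s)) ^ n * u y ∧
        s < Real.exp (hypDist x y) - 1) := by
  refine ⟨?_, ?_⟩
  · rintro s C u hs hs₁ hC - hu x hx y hy r t hr rfl
    have hr_mem : r ∈ Set.Icc (-1) 1 :=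
      hr ▸ Set.Ioo_subset_Icc_self (Real.tanh_bijOn.mapsTo (Set.mem_univ (hypDist x y / 2)))
    rw [log_one_add_div_one_sub hr_mem, log_one_add_div_one_sub ⟨by linarith, hs₁.le⟩, hr,
      Real.artanh_tanh, mul_div_cancel₀ _ (two_ne_zero' ℝ)]
    exact hu.le_rpow_mul hs hs₁ hC hx hy
  · intro u hu hpos x hx s hs hs₁ y hy
    have hR : 0 < 1 - ‖x‖ := sub_pos.2 (mem_ball_zero_iff.1 hx)
    have hsub : ball x (1 - ‖x‖) ⊆ ball (0 : EuclideanSpace ℝ (Fin n)) 1 :=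
      ball_subset_ball' (by simp)
    have hy_mem : y ∈ ball (0 : EuclideanSpace ℝ (Fin n)) 1 :=
      hsub (sphere_subset_ball (by nlinarith) hy)
    constructor
    · have hharnack := le_inv_one_sub_pow_mul_of_mem_sphere hR (hu.mono hsub)
        (fun z hz ↦ (hpos z (hsub hz)).le) hs₁ hy
      rw [finrank_euclideanSpace_fin] at hharnack
      exact hharnack.trans (mul_le_mul_of_nonneg_right
        (inv_one_sub_pow_succ_le hs.le hs₁ (by lia)) (hpos y hy_mem).le)
    · have hexp := one_add_dist_div_lt_exp_hypDist hx hy_mem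
        (ne_of_mem_sphere hy (mul_pos hs hR).ne').symm
      rw [dist_comm, mem_sphere.1 hy, mul_div_cancel_right₀ _ hR.ne'] at hexp
      linarith
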